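/- Let $\mu$ be a regular uncountable cardinal (possibly inaccessible), let $\lambda=\mu^+$, and let $S\subseteq\{\delta<\lambda:\operatorname{cf}(\delta)=\mu\}$ be stationary in $\lambda$. Then there are a strict $S$-club system $\bar C=\langle C_\delta:\delta\in S\rangle$ (that is, for every $\delta\in S$, $C_\delta$ is a closed unbounded subset of $\delta$ of order type $\operatorname{cf}(\delta)$) and, for each $\delta\in S$, an enumeration $C_\delta=\{\alpha_{\delta,\zeta}:\zeta<\mu\}$, strictly increasing and continuous in $\zeta$, such that for every club $E$ of $\lambda$ the set $$\{\delta\in S:\{\zeta<\mu:\alpha_{\delta,\zeta+1}\in E\}\text{ is a stationary subset of }\mu\}$$ is a stationary subset of $\lambda$. -/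

import Mathlib

universe u

/-- `C` is a club of the ordinal `o`: a subset of `o = {x | x < o}` which is closed in `o` and
cofinal in `o`. -/
def IsClubIn (C : Set Ordinal.{u}) (o : Ordinal.{u}) : Prop :=
  C ⊆ Set.Iio o ∧ IsClub ((fun x : Set.Iio o => x.1) ⁻¹' C)

/-- `T` is a stationary subset of the ordinal `o`: it is a subset of `o` which meets every club
of `o`. -/
def IsStationaryIn (T : Set Ordinal.{u}) (o : Ordinal.{u}) : Prop :=
  T ⊆ Set.Iio o ∧ ∀ C : Set Ordinal.{u}, IsClubIn C o → (T ∩ C).Nonempty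

/-- `⟨C δ : δ ∈ S⟩` is a strict `S`-club system: for each `δ ∈ S`, `δ` is a limit ordinal and
`C δ` is a club of `δ` whose order type is the cofinality of `δ`. The values `C δ` for `δ ∉ S`
play no role. -/
structure IsStrictClubSystem (S : Set Ordinal.{u}) (C : Ordinal.{u} → Set Ordinal.{u}) : Prop where
  isSuccLimit : ∀ δ ∈ S, Order.IsSuccLimit δ
  isClubIn : ∀ δ ∈ S, IsClubIn (C δ) δ
  /-- The order type of a set of ordinals of `Ordinal.{u}` lives one universe up. -/
  orderType_eq : ∀ δ ∈ S,
    Ordinal.type (fun x y : C δ => x < y) = Ordinal.lift.{u + 1} δ.cof.ord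

/-- The sequence `⟨a ζ : ζ < o⟩` is a strictly increasing continuous enumeration of `C`.
The values `a ζ` for `ζ ≥ o` play no role. -/
structure IsContEnum (a : Ordinal.{u} → Ordinal.{u}) (o : Ordinal.{u}) (C : Set Ordinal.{u}) :
    Prop where
  strictMonoOn : StrictMonoOn a (Set.Iio o)
  continuous : ∀ ζ < o, Order.IsSuccLimit ζ → IsLUB (a '' Set.Iio ζ) (a ζ)
  image_eq : a '' Set.Iio o = C

open Ordinal

/-! Fix a continuous cofinal ladder `a δ` of length `μ` in each `δ ∈ S`.

Gaps (`exists_jump_function`): some `h δ : μ → μ` makes every club `E` meet `(a δ ζ, a δ (h δ ζ)]`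
for stationarily many `ζ`, for some `δ ∈ S ∩ E`. Otherwise, thin the index clubs `ω` times, each
time against a club `E n` that misses the gaps of the current one. In the limit the next point after
`x` is the supremum over `n` of the least point of `E n` above `x`, whatever `δ` is. Limit ladders
for different `δ` are therefore disjoint, and choosing a point from each gives an injective
regressive function on a stationary set.

Guessing (`exists_lastPoint_guess`): some fixed `E₀` has its last point up to `a δ (h δ ζ)` in any
prescribed club, stationarily often. Otherwise, shrink `E₀` `ω` times; the last points decrease,
hence stabilise, and a stable one lies in the club it should avoid.

Finally, iterate `h δ` continuously to `k δ` and use the guessed points as successor entries. At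
fixed points of `k δ` the entry after `ζ` is the last point computed at `ζ`. -/

/-! ### Clubs of ordinals and closure points. -/

theorem isClubIn_iff {C : Set Ordinal.{u}} {o : Ordinal.{u}} :
    IsClubIn C o ↔ C ⊆ Set.Iio o ∧
      (∀ t ⊆ C, t.Nonempty → ∀ x < o, IsLUB t x → x ∈ C) ∧ ∀ x < o, ∃ y ∈ C, x ≤ y := by
  refine and_congr_right fun hC ↦ ?_
  rw [isClub_iff]
  refine and_congr ⟨fun h t ht hne x hx hlub ↦ ?_, fun h t ht hne _ x hlub ↦ ?_⟩
    ⟨fun h x hx ↦ ?_, fun h x ↦ ?_⟩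
  · refine @h ((fun x : Set.Iio o ↦ x.1) ⁻¹' t) (fun y hy ↦ ht hy) ?_ (.of_linearOrder _) ⟨x, hx⟩ ?_
    · obtain ⟨y, hy⟩ := hne
      exact ⟨⟨y, hC (ht hy)⟩, hy⟩
    · exact ⟨fun y hy ↦ hlub.1 hy, fun y hy ↦ hlub.2 fun z hz ↦
        hy (show (⟨z, hC (ht hz)⟩ : Set.Iio o) ∈ _ from hz)⟩
  · refine h (Subtype.val '' t) ?_ (hne.image _) x x.2 ⟨?_, fun y hy ↦ ?_⟩
    · rintro _ ⟨y, hy, rfl⟩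
      exact ht hy
    · rintro _ ⟨y, hy, rfl⟩
      exact hlub.1 hy
    · by_contra! hlt
      exact (@hlub.2 ⟨y, hlt.trans x.2⟩ fun z hz ↦ hy ⟨z, hz, rfl⟩).not_gt hlt
  · obtain ⟨y, hy, hxy⟩ := h ⟨x, hx⟩
    exact ⟨y, hy, hxy⟩
  · obtain ⟨y, hy, hxy⟩ := h x x.2
    exact ⟨⟨y, hC hy⟩, hy, hxy⟩

namespace IsClubIn

variable {C D : Set Ordinal.{u}} {o x : Ordinal.{u}}

theorem lt (h : IsClubIn C o) (hx : x ∈ C) : x < o := h.1 hx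

theorem mem_of_isLUB (h : IsClubIn C o) {t : Set Ordinal.{u}} (ht : t ⊆ C) (hne : t.Nonempty)
    (hx : x < o) (hlub : IsLUB t x) : x ∈ C :=
  (isClubIn_iff.1 h).2.1 t ht hne x hx hlub

theorem exists_ge (h : IsClubIn C o) (hx : x < o) : ∃ y ∈ C, x ≤ y :=
  (isClubIn_iff.1 h).2.2 x hx

theorem exists_gt (h : IsClubIn C o) (ho : Order.IsSuccLimit o) (hx : x < o) : ∃ y ∈ C, x < y := by
  obtain ⟨y, hy, hxy⟩ := h.exists_ge (ho.succ_lt hx)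
  exact ⟨y, hy, Order.succ_le_iff.1 hxy⟩

theorem Iio (o : Ordinal.{u}) : IsClubIn (Set.Iio o) o :=
  isClubIn_iff.2 ⟨subset_rfl, fun _ _ _ _ hx _ ↦ hx, fun x hx ↦ ⟨x, hx, le_rfl⟩⟩

theorem iInter {C : ℕ → Set Ordinal.{u}} (ho : Cardinal.aleph0 < o.cof)
    (h : ∀ n, IsClubIn (C n) o) : IsClubIn (⋂ n, C n) o := by
  refine ⟨(Set.iInter_subset _ 0).trans (h 0).1, ?_⟩
  rw [Set.preimage_iInter]
  refine IsClub.iInter_of_countable ?_ fun n ↦ (h n).2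
  rw [cof_Iio, ← lift_cof]
  intro h0
  rw [Cardinal.lift_eq_aleph0] at h0
  exact ho.ne' h0

theorem inter (ho : Cardinal.aleph0 < o.cof) (hC : IsClubIn C o) (hD : IsClubIn D o) :
    IsClubIn (C ∩ D) o := by
  have := iInter (C := fun n ↦ n.casesOn C fun _ ↦ D) ho (by rintro (_ | _) <;> assumption)
  convert this using 1
  ext x
  simp only [Set.mem_inter_iff, Set.mem_iInter]
  exact ⟨by rintro h (_ | _); exacts [h.1, h.2], fun h ↦ ⟨h 0, h 1⟩⟩

end IsClubIn

theorem not_isStationaryIn {T : Set Ordinal.{u}} {o : Ordinal.{u}} (hT : T ⊆ Set.Iio o)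
    (h : ¬ IsStationaryIn T o) : ∃ C, IsClubIn C o ∧ ∀ x ∈ C, x ∉ T := by
  by_contra! hcon
  exact h ⟨hT, fun C hC ↦ (hcon C hC).imp fun x hx ↦ ⟨hx.2, hx.1⟩⟩

theorem exists_forall_lt_of_card_lt_cof {x o : Ordinal.{u}} (hx : x.card < o.cof)
    {F : Ordinal.{u} → Ordinal.{u}} (hF : ∀ y < x, F y < o) : ∃ b < o, ∀ y < x, F y < b := by
  refine ⟨⨆ y : Set.Iio x, F y + 1, lift_iSup_add_one_lt_of_lt_cof ?_ fun y ↦ hF y y.2,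
    fun y hy ↦ Ordinal.lt_iSup_add_one (fun y : Set.Iio x ↦ F y) ⟨y, hy⟩⟩
  rw [Cardinal.mk_Iio_ordinal, ← lift_cof, Cardinal.lift_lift]
  exact Cardinal.lift_lt.2 hx

theorem isClubIn_closurePoints {c : Cardinal.{u}} (hc : c.IsRegular) (hc' : Cardinal.aleph0 < c)
    {g : Ordinal.{u} → Ordinal.{u}} (hg : ∀ x < c.ord, g x < c.ord) :
    IsClubIn {x | x < c.ord ∧ 0 < x ∧ ∀ y < x, g y < x} c.ord := by
  have hlim : Order.IsSuccLimit c.ord := Cardinal.isSuccLimit_ord hc.aleph0_le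
  have key : ∀ x < c.ord, ∃ b < c.ord, x < b ∧ ∀ y < x, g y < b := by
    intro x hx
    obtain ⟨b, hb, h⟩ := exists_forall_lt_of_card_lt_cof (F := g)
      (by rwa [hc.cof_ord, ← Cardinal.lt_ord]) (fun y hy ↦ hg y (hy.trans hx))
    exact ⟨max b (Order.succ x), max_lt hb (hlim.succ_lt hx), by simp, fun y hy ↦
      (h y hy).trans_le (le_max_left _ _)⟩
  choose! G hG hxG hgG using key
  refine isClubIn_iff.2 ⟨fun x hx ↦ hx.1, fun t ht hne x hx hlub ↦ ⟨hx, ?_, fun y hy ↦ ?_⟩,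
    fun x hx ↦ ?_⟩
  · obtain ⟨z, hz⟩ := hne
    exact (ht hz).2.1.trans_le (hlub.1 hz)
  · obtain ⟨z, hz, hyz, -⟩ := hlub.exists_between hy
    exact ((ht hz).2.2 y hyz).trans_le (hlub.1 hz)
  · have hit : ∀ n, G^[n] x < c.ord := by
      intro n
      induction n with
      | zero => exact hx
      | succ n ih => rw [Function.iterate_succ_apply']; exact hG _ ih
    have hlt : ∀ n, G^[n] x < nfp G x := fun n ↦ by
      refine (hxG _ (hit n)).trans_le ?_
      rw [← Function.iterate_succ_apply' G]
      exact iterate_le_nfp G x _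
    refine ⟨nfp G x, ⟨nfp_lt_ord (by rwa [hc.cof_ord]) hG hx, zero_le.trans_lt (hlt 0),
      fun y hy ↦ ?_⟩, (hlt 0).le⟩
    obtain ⟨n, hn⟩ := lt_nfp_iff.1 hy
    refine (hgG _ (hit n) y hn).trans_le ?_
    rw [← Function.iterate_succ_apply' G]
    exact iterate_le_nfp G x _

/-! ### Ladders: existence and transfer of clubs along them. -/

/-- `⟨a ζ : ζ < o⟩` is a strictly increasing continuous sequence cofinal in `δ`. -/
structure IsLadder (a : Ordinal.{u} → Ordinal.{u}) (o δ : Ordinal.{u}) : Prop where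
  strictMonoOn : StrictMonoOn a (Set.Iio o)
  continuous : ∀ ζ < o, Order.IsSuccLimit ζ → IsLUB (a '' Set.Iio ζ) (a ζ)
  lt : ∀ ζ < o, a ζ < δ
  cofinal : ∀ x < δ, ∃ ζ < o, x < a ζ

theorem exists_continuous_recursion {c : Cardinal.{u}} (hc : c.IsRegular) {δ : Ordinal.{u}}
    (hδ : δ.cof = c) (g : Ordinal.{u} → Ordinal.{u} → Ordinal.{u})
    (hg : ∀ ζ < c.ord, ∀ x < δ, x < g ζ x ∧ g ζ x < δ) :
    ∃ k : Ordinal.{u} → Ordinal.{u}, StrictMonoOn k (Set.Iio c.ord) ∧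
      (∀ ζ < c.ord, Order.IsSuccLimit ζ → IsLUB (k '' Set.Iio ζ) (k ζ)) ∧
      (∀ ζ < c.ord, k ζ < δ) ∧ ∀ ζ, k (ζ + 1) = g ζ (k ζ) := by
  have hclim : Order.IsSuccLimit c.ord := Cardinal.isSuccLimit_ord hc.aleph0_le
  have hδ0 : 0 < δ := cof_pos.1 (hδ ▸ hc.pos)
  obtain ⟨k, hk0, hks, hkl⟩ : ∃ k : Ordinal.{u} → Ordinal.{u}, k 0 = 0 ∧
      (∀ ζ, k (ζ + 1) = g ζ (k ζ)) ∧
      ∀ ζ, Order.IsSuccLimit ζ → k ζ = ⨆ y : Set.Iio ζ, k y := by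
    refine ⟨fun ζ ↦ limitRecOn ζ 0 g fun ζ _ ih ↦ ⨆ y : Set.Iio ζ, ih y y.2, ?_, fun ζ ↦ ?_,
      fun ζ hζ ↦ ?_⟩
    · exact limitRecOn_zero ..
    · exact limitRecOn_add_one ..
    · exact limitRecOn_limit _ _ _ _ hζ
  have hle : ∀ ζ, Order.IsSuccLimit ζ → ∀ y < ζ, k y ≤ k ζ := fun ζ hζ y hy ↦ by
    rw [hkl ζ hζ]
    exact Ordinal.le_iSup (fun y : Set.Iio ζ ↦ k y) ⟨y, hy⟩
  have hlt : ∀ ζ, ζ < c.ord → k ζ < δ := by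
    intro ζ
    induction ζ using limitRecOn with
    | zero => intro _; rwa [hk0]
    | add_one ζ ih =>
      intro h
      have h' : ζ < c.ord := (lt_add_one ζ).trans h
      rw [hks]
      exact (hg ζ h' _ (ih h')).2
    -- Fewer than `cof δ` values have been used so far, so their supremum stays below `δ`.
    | limit ζ hζ ih =>
      intro h
      obtain ⟨b, hb, hb'⟩ := exists_forall_lt_of_card_lt_cof (x := ζ) (o := δ) (F := k)
        (by rwa [hδ, ← Cardinal.lt_ord]) fun y hy ↦ ih y hy (hy.trans h)
      rw [hkl ζ hζ]
      exact (Ordinal.iSup_le fun y : Set.Iio ζ ↦ (hb' y y.2).le).trans_lt hb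
  have hmono : ∀ ζ, ζ < c.ord → ∀ y < ζ, k y < k ζ := by
    intro ζ
    induction ζ using limitRecOn with
    | zero => intro _ y hy; simp at hy
    | add_one ζ ih =>
      intro h y hy
      have h' : ζ < c.ord := (lt_add_one ζ).trans h
      have h2 : k ζ < k (ζ + 1) := by rw [hks]; exact (hg ζ h' _ (hlt ζ h')).1
      obtain rfl | hy := (Order.lt_add_one_iff.1 hy).eq_or_lt
      exacts [h2, (ih h' y hy).trans h2]
    | limit ζ hζ ih =>
      intro h y hy
      have hy1 : y + 1 < ζ := hζ.succ_lt hy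
      exact (ih _ hy1 (hy1.trans h) y (lt_add_one y)).trans_le (hle ζ hζ _ hy1)
  refine ⟨k, fun x _ y hy hxy ↦ hmono y hy x hxy, fun ζ _ hζ ↦ ⟨?_, fun b hb ↦ ?_⟩, hlt, hks⟩
  · rintro _ ⟨y, hy, rfl⟩
    exact hle ζ hζ y hy
  · rw [hkl ζ hζ]
    exact Ordinal.iSup_le fun y : Set.Iio ζ ↦ hb ⟨y, y.2, rfl⟩

theorem exists_isLadder {c : Cardinal.{u}} (hc : c.IsRegular) {δ : Ordinal.{u}}
    (hδ : δ.cof = c) : ∃ a, IsLadder a c.ord δ := by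
  have hlim : Order.IsSuccLimit δ := by
    rw [← one_lt_cof_iff, hδ]
    exact Cardinal.one_lt_aleph0.trans_le hc.aleph0_le
  have hclim : Order.IsSuccLimit c.ord := Cardinal.isSuccLimit_ord hc.aleph0_le
  obtain ⟨f, hf, hfc⟩ : ∃ f : Ordinal.{u} → Ordinal.{u}, (∀ ζ < c.ord, f ζ < δ) ∧
      ∀ x < δ, ∃ ζ < c.ord, x ≤ f ζ := by
    obtain ⟨s, hs, hs'⟩ := Order.exists_cof_eq (α := δ.ToType)
    rw [cof_toType, hδ] at hs'
    obtain ⟨e⟩ : Nonempty (c.ord.ToType ≃ s) := by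
      rw [← Cardinal.eq, hs', Cardinal.mk_toType, Cardinal.card_ord]
    obtain ⟨F, hF⟩ : ∃ F : Set.Iio c.ord → Set.Iio δ, ∀ x, ∃ y, x ≤ F y := by
      refine ⟨fun ζ ↦ ToType.mk.symm (e (ToType.mk ζ)), fun x ↦ ?_⟩
      obtain ⟨y, hy, hxy⟩ := hs (ToType.mk x)
      refine ⟨ToType.mk.symm (e.symm ⟨y, hy⟩), ?_⟩
      simpa using ToType.mk.symm.monotone hxy
    refine ⟨fun ζ ↦ if h : ζ ∈ Set.Iio c.ord then (F ⟨ζ, h⟩).1 else 0, fun ζ h ↦ ?_,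
      fun x hx ↦ ?_⟩
    · have h' : ζ ∈ Set.Iio c.ord := h
      beta_reduce
      rw [dif_pos h']
      exact (F ⟨ζ, h'⟩).2
    · obtain ⟨y, hy⟩ := hF ⟨x, hx⟩
      refine ⟨y, y.2, ?_⟩
      beta_reduce
      rw [dif_pos y.2]
      exact hy
  obtain ⟨k, hk, hkc, hkδ, hks⟩ := exists_continuous_recursion hc hδ
    (fun ζ x ↦ max (Order.succ x) (Order.succ (f ζ)))
    fun ζ hζ x hx ↦ ⟨by simp, max_lt (hlim.succ_lt hx) (hlim.succ_lt (hf ζ hζ))⟩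
  refine ⟨k, hk, hkc, hkδ, fun x hx ↦ ?_⟩
  obtain ⟨ζ, hζ, hx⟩ := hfc x hx
  refine ⟨ζ + 1, hclim.succ_lt hζ, ?_⟩
  rw [hks]
  exact hx.trans_lt (by simp)

namespace IsLadder

variable {a : Ordinal.{u} → Ordinal.{u}} {o δ : Ordinal.{u}}

theorem lt_iff (h : IsLadder a o δ) {x y : Ordinal.{u}} (hx : x < o) (hy : y < o) :
    a x < a y ↔ x < y :=
  h.strictMonoOn.lt_iff_lt hx hy

theorem le_iff (h : IsLadder a o δ) {x y : Ordinal.{u}} (hx : x < o) (hy : y < o) :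
    a x ≤ a y ↔ x ≤ y :=
  h.strictMonoOn.le_iff_le hx hy

theorem isLUB_image (h : IsLadder a o δ) {t : Set Ordinal.{u}} (hne : t.Nonempty)
    {x : Ordinal.{u}} (hx : x < o) (hlub : IsLUB t x) : IsLUB (a '' t) (a x) := by
  have ht : t ⊆ Set.Iio o := fun y hy ↦ (hlub.1 hy).trans_lt hx
  have hub : a x ∈ upperBounds (a '' t) := by
    rintro _ ⟨y, hy, rfl⟩
    exact (h.le_iff (ht hy) hx).2 (hlub.1 hy)
  by_cases hxt : x ∈ t
  · exact ⟨hub, fun b hb ↦ hb ⟨x, hxt, rfl⟩⟩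
  · refine ⟨hub, fun b hb ↦ ?_⟩
    have hlim : Order.IsSuccLimit x := by
      obtain ⟨y, hy⟩ := hne
      exact hlub.isSuccLimit_of_notMem ⟨y, hy⟩ hxt
    refine (h.continuous x hx hlim).2 ?_
    rintro _ ⟨y, hy, rfl⟩
    obtain ⟨z, hz, hyz, -⟩ := hlub.exists_between hy
    exact ((h.le_iff (hy.trans hx) (ht hz)).2 hyz.le).trans (hb ⟨z, hz, rfl⟩)

theorem isClubIn_image (h : IsLadder a o δ) {D : Set Ordinal.{u}} (hD : IsClubIn D o) :
    IsClubIn (a '' D) δ := by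
  refine isClubIn_iff.2 ⟨?_, fun t ht hne x hx hlub ↦ ?_, fun x hx ↦ ?_⟩
  · rintro _ ⟨y, hy, rfl⟩
    exact h.lt y (hD.lt hy)
  · obtain ⟨ζ, hζ, hxζ⟩ := h.cofinal x hx
    obtain ⟨s, hs, rfl⟩ := Set.subset_image_iff.1 ht
    have hsne : s.Nonempty := Set.image_nonempty.1 hne
    have hbd : ∀ y ∈ s, y ≤ ζ := fun y hy ↦
      (h.le_iff (hD.lt (hs hy)) hζ).1 ((hlub.1 ⟨y, hy, rfl⟩).trans hxζ.le)
    have hsup : IsLUB s (sSup s) := isLUB_csSup hsne ⟨ζ, hbd⟩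
    have hlt : sSup s < o := (hsup.2 hbd).trans_lt hζ
    exact ⟨sSup s, hD.mem_of_isLUB hs hsne hlt hsup, (h.isLUB_image hsne hlt hsup).unique hlub⟩
  · obtain ⟨ζ, hζ, hxζ⟩ := h.cofinal x hx
    obtain ⟨y, hy, hζy⟩ := hD.exists_ge hζ
    exact ⟨a y, ⟨y, hy, rfl⟩, hxζ.le.trans ((h.le_iff hζ (hD.lt hy)).2 hζy)⟩

/-- A club `E` whose intersection with `δ` is cofinal in `δ` meets a ladder to `δ` in a club of
indices. -/
theorem isClubIn_preimage {c : Cardinal.{u}} (hc : c.IsRegular) (hc' : Cardinal.aleph0 < c)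
    (h : IsLadder a c.ord δ) {E : Set Ordinal.{u}} {l : Ordinal.{u}} (hE : IsClubIn E l)
    (hδ : δ ≤ l) (hEδ : ∀ x < δ, ∃ e ∈ E, x < e ∧ e < δ) :
    IsClubIn {ζ | ζ < c.ord ∧ a ζ ∈ E} c.ord := by
  have key : ∀ ζ < c.ord, ∃ ξ < c.ord, ∃ e ∈ E, a ζ < e ∧ e < a ξ := by
    intro ζ hζ
    obtain ⟨e, he, hle, hlt⟩ := hEδ _ (h.lt ζ hζ)
    obtain ⟨ξ, hξ, h'⟩ := h.cofinal e hlt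
    exact ⟨ξ, hξ, e, he, hle, h'⟩
  choose! g hg e heE hle hlt using key
  refine isClubIn_iff.2 ⟨fun x hx ↦ hx.1, fun t ht hne x hx hlub ↦ ⟨hx, ?_⟩, fun x hx ↦ ?_⟩
  · refine hE.mem_of_isLUB ?_ (hne.image a) ((h.lt x hx).trans_le hδ) (h.isLUB_image hne hx hlub)
    rintro _ ⟨y, hy, rfl⟩
    exact (ht hy).2
  -- At a closure point `y` of `g` the points `e z`, `z < y`, interleave with the ladder, so `a y`
  -- is their supremum and lies in `E`.
  · obtain ⟨y, ⟨hy, hy0, hgy⟩, hxy⟩ := (isClubIn_closurePoints hc hc' hg).exists_ge hx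
    refine ⟨y, ⟨hy, ?_⟩, hxy⟩
    have hlim : Order.IsSuccLimit y := by
      refine Ordinal.isSuccLimit_iff.2 ⟨hy0.ne', Order.isSuccPrelimit_of_succ_ne fun z hz ↦ ?_⟩
      have hzy : z < y := hz ▸ Order.lt_succ z
      refine (hgy z hzy).not_ge (hz ▸ Order.succ_le_of_lt ?_)
      exact (h.lt_iff (hzy.trans hy) (hg z (hzy.trans hy))).1
        ((hle z (hzy.trans hy)).trans (hlt z (hzy.trans hy)))
    have hlub := h.continuous y hy hlim
    refine hE.mem_of_isLUB (t := e '' Set.Iio y) ?_ ⟨_, 0, hy0, rfl⟩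
      ((h.lt y hy).trans_le hδ) ⟨?_, fun b hb ↦ hlub.2 ?_⟩
    · rintro _ ⟨z, hz, rfl⟩
      exact heE z (lt_trans hz hy)
    · rintro _ ⟨z, hz, rfl⟩
      exact ((hlt z (lt_trans hz hy)).trans
        ((h.lt_iff (hg z (lt_trans hz hy)) hy).2 (hgy z hz))).le
    · rintro _ ⟨z, hz, rfl⟩
      exact (hle z (lt_trans hz hy)).le.trans (hb ⟨z, hz, rfl⟩)

end IsLadder

/-- The injective case of Fodor's lemma: a point `δ` of `S` closed under the inverse `g` of `f`
would satisfy `δ = g (f δ) < δ`. -/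
theorem not_isStationaryIn_of_injOn_regressive {c : Cardinal.{u}} (hc : c.IsRegular)
    (hc' : Cardinal.aleph0 < c) {S : Set Ordinal.{u}} {f : Ordinal.{u} → Ordinal.{u}}
    (hf : ∀ δ ∈ S, f δ < δ) (hinj : Set.InjOn f S) : ¬ IsStationaryIn S c.ord := by
  rintro ⟨hS, hstat⟩
  classical
  let g : Ordinal.{u} → Ordinal.{u} := fun x ↦ if h : ∃ δ ∈ S, f δ = x then h.choose else 0
  have hg : ∀ x < c.ord, g x < c.ord := by
    intro x _
    by_cases h : ∃ δ ∈ S, f δ = x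
    · simp only [g, dif_pos h]
      exact hS h.choose_spec.1
    · simp only [g, dif_neg h]
      exact hc.ord_pos
  obtain ⟨δ, hδ, -, -, hcl⟩ := hstat _ (isClubIn_closurePoints hc hc' hg)
  have h : ∃ δ' ∈ S, f δ' = f δ := ⟨δ, hδ, rfl⟩
  have hgδ : g (f δ) = δ := by
    simp only [g, dif_pos h]
    exact hinj h.choose_spec.1 hδ h.choose_spec.2
  exact (hcl _ (hf δ hδ)).ne hgδ

/-- A club of `δ` and the image of a club under a ladder to a larger ordinal are disjoint if they
are closed under a common strictly increasing function. -/
theorem IsLadder.disjoint_of_closed {c : Cardinal.{u}} {δ δ' : Ordinal.{u}} (hδ : δ.cof = c)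
    (hlt : δ < δ') {a : Ordinal.{u} → Ordinal.{u}} (ha : IsLadder a c.ord δ')
    {A D : Set Ordinal.{u}} (hA : IsClubIn A δ) (hD : IsClubIn D c.ord)
    {σ : Ordinal.{u} → Ordinal.{u}} (hσ : ∀ x ∈ A, x < σ x ∧ σ x ∈ A)
    (hσ' : ∀ x ∈ a '' D, σ x ∈ a '' D) : Disjoint A (a '' D) := by
  rw [Set.disjoint_iff_inter_eq_empty, ← Set.not_nonempty_iff_eq_empty]
  intro hne
  have hbd : δ ∈ upperBounds (A ∩ a '' D) := fun x hx ↦ (hA.lt hx.1).le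
  have hlub : IsLUB (A ∩ a '' D) (sSup (A ∩ a '' D)) := isLUB_csSup hne ⟨δ, hbd⟩
  have himg := ha.isClubIn_image hD
  obtain h | h := (hlub.2 hbd).lt_or_eq
  -- A supremum below `δ` is a common point, and `σ` of it is a larger one.
  · have h1 := hA.mem_of_isLUB Set.inter_subset_left hne h hlub
    have h2 := himg.mem_of_isLUB Set.inter_subset_right hne (h.trans hlt) hlub
    exact (hlub.1 ⟨(hσ _ h1).2, hσ' _ h2⟩).not_gt (hσ _ h1).1
  -- Otherwise `δ` is itself a ladder point `a ξ`, and the fewer than `μ` ladder points below it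
  -- would be cofinal in `δ`.
  · rw [h] at hlub
    obtain ⟨ξ, hξD, hξ⟩ := himg.mem_of_isLUB Set.inter_subset_right hne hlt hlub
    have hξc : ξ < c.ord := hD.lt hξD
    obtain ⟨b, hb, hb'⟩ := exists_forall_lt_of_card_lt_cof (x := ξ) (o := δ) (F := a)
      (by rwa [hδ, ← Cardinal.lt_ord])
      fun y hy ↦ hξ ▸ (ha.lt_iff (lt_trans hy hξc) hξc).2 hy
    refine (hlub.2 fun x hx ↦ ?_).not_gt hb
    obtain ⟨y, hy, rfl⟩ := hx.2
    exact (hb' y ((ha.lt_iff (hD.lt hy) hξc).1 (hξ ▸ hA.lt hx.1))).le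

/-! ### Gaps met by every club. -/

section Gap

variable {μ lam : Cardinal.{u}} {S : Set Ordinal.{u}} {a : Ordinal.{u} → Ordinal.{u} → Ordinal.{u}}

/-- The set of indices at which `E` has a point between the `ζ`-th and the `h ζ`-th element of the
sequence `a`. -/
def jumpSet (a h : Ordinal.{u} → Ordinal.{u}) (E : Set Ordinal.{u}) (o : Ordinal.{u}) :
    Set Ordinal.{u} :=
  {ζ | ζ < o ∧ ∃ e ∈ E, a ζ < e ∧ e ≤ a (h ζ)}

/-- One thinning step: the failure is applied to the function sending `ζ` to the next element of `d
δ`. `E'` consists of points of `E` that are limits of `E`, so that the ladder to such a `δ` meets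
`E` on a club of indices. -/
theorem exists_refinement_of_no_jump (hμ : μ.IsRegular) (hμ' : Cardinal.aleph0 < μ)
    (hlam : lam.IsRegular) (hlam' : Cardinal.aleph0 < lam)
    (ha : ∀ δ ∈ S, IsLadder (a δ) μ.ord δ)
    (hno : ∀ h : Ordinal.{u} → Ordinal.{u} → Ordinal.{u},
      (∀ δ ∈ S, ∀ ζ < μ.ord, ζ < h δ ζ ∧ h δ ζ < μ.ord) →
      ∃ E, IsClubIn E lam.ord ∧
        ∀ δ ∈ S, δ ∈ E → ¬ IsStationaryIn (jumpSet (a δ) (h δ) E μ.ord) μ.ord)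
    (d : Ordinal.{u} → Set Ordinal.{u}) (hd : ∀ δ ∈ S, IsClubIn (d δ) μ.ord) :
    ∃ (d' : Ordinal.{u} → Set Ordinal.{u}) (E E' : Set Ordinal.{u}),
      (∀ δ ∈ S, IsClubIn (d' δ) μ.ord) ∧ IsClubIn E lam.ord ∧ IsClubIn E' lam.ord ∧
      (∀ δ ∈ S, d' δ ⊆ d δ) ∧
      ∀ δ ∈ S, δ ∈ E' → ∀ ζ ∈ d' δ, a δ ζ ∈ E ∧
        ∀ ξ, IsLeast {ξ | ξ ∈ d δ ∧ ζ < ξ} ξ → ∀ e ∈ E, a δ ζ < e → a δ ξ < e := by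
  have hμlim : Order.IsSuccLimit μ.ord := Cardinal.isSuccLimit_ord hμ.aleph0_le
  have hllim : Order.IsSuccLimit lam.ord := Cardinal.isSuccLimit_ord hlam.aleph0_le
  have hleast : ∀ δ ∈ S, ∀ ζ < μ.ord, ∃ ξ, IsLeast {ξ | ξ ∈ d δ ∧ ζ < ξ} ξ := fun δ hδ ζ hζ ↦ by
    obtain ⟨y, hy, hζy⟩ := (hd δ hδ).exists_gt hμlim hζ
    exact ⟨_, isLeast_csInf ⟨y, hy, hζy⟩⟩
  choose! h hh using hleast
  obtain ⟨E, hE, hE'⟩ := hno h fun δ hδ ζ hζ ↦ ⟨(hh δ hδ ζ hζ).1.2, (hd δ hδ).lt (hh δ hδ ζ hζ).1.1⟩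
  choose! g hgE hgt using fun x (hx : x < lam.ord) ↦ hE.exists_gt hllim hx
  have hacc := isClubIn_closurePoints hlam hlam' fun x hx ↦ hE.lt (hgE x hx)
  have key : ∀ δ, ∃ D, δ ∈ S → IsClubIn D μ.ord ∧ D ⊆ d δ ∧
      (δ ∈ E ∩ {x | x < lam.ord ∧ 0 < x ∧ ∀ y < x, g y < x} → ∀ ζ ∈ D, a δ ζ ∈ E ∧
        ∀ ξ, IsLeast {ξ | ξ ∈ d δ ∧ ζ < ξ} ξ → ∀ e ∈ E, a δ ζ < e → a δ ξ < e) := by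
    intro δ
    by_cases hδ : δ ∈ S ∧ δ ∈ E ∩ {x | x < lam.ord ∧ 0 < x ∧ ∀ y < x, g y < x}
    · obtain ⟨hδS, hδE, hδl, -, hcl⟩ := hδ
      obtain ⟨C, hC, hCj⟩ := not_isStationaryIn (fun ζ hζ ↦ hζ.1) (hE' δ hδS hδE)
      have hpre := (ha δ hδS).isClubIn_preimage hμ hμ' hE hδl.le fun x hx ↦
        ⟨g x, hgE x (hx.trans hδl), hgt x (hx.trans hδl), hcl x hx⟩
      have hcof : Cardinal.aleph0 < μ.ord.cof := by rwa [hμ.cof_ord]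
      refine ⟨d δ ∩ (C ∩ {ζ | ζ < μ.ord ∧ a δ ζ ∈ E}), fun _ ↦ ⟨(hd δ hδS).inter hcof
        (hC.inter hcof hpre), Set.inter_subset_left, fun _ ζ hζ ↦ ⟨hζ.2.2.2, fun ξ hξ e he hlt ↦ ?_⟩⟩⟩
      by_contra! hle
      refine hCj ζ hζ.2.1 ⟨hζ.2.2.1, e, he, hlt, ?_⟩
      rwa [(hh δ hδS ζ hζ.2.2.1).unique hξ]
    · exact ⟨d δ, fun hδS ↦ ⟨hd δ hδS, subset_rfl, fun h' ↦ absurd ⟨hδS, h'⟩ hδ⟩⟩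
  choose d' hd' using key
  exact ⟨d', E, _, fun δ hδ ↦ (hd' δ hδ).1, hE,
    hE.inter (by rwa [hlam.cof_ord]) hacc, fun δ hδ ↦ (hd' δ hδ).2.1, fun δ hδ ↦ (hd' δ hδ).2.2⟩

/-- The successor of an index in the limit of a decreasing sequence of clubs, each of which skips
the gaps of the next, is determined by the value of the ladder there. -/
theorem exists_next_of_refinements {o δ l : Ordinal.{u}} (ho : Order.IsSuccLimit o)
    (ho' : Cardinal.aleph0 < o.cof) (hδ : δ < l) (hl : Order.IsSuccLimit l)
    {a : Ordinal.{u} → Ordinal.{u}}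
    (ha : IsLadder a o δ) {d E : ℕ → Set Ordinal.{u}} (hd : ∀ n, IsClubIn (d n) o)
    (hE : ∀ n, IsClubIn (E n) l) (hsub : ∀ n, d (n + 1) ⊆ d n)
    (hgap : ∀ n, ∀ ζ ∈ d (n + 1), a ζ ∈ E n ∧
        ∀ ξ, IsLeast {ξ | ξ ∈ d n ∧ ζ < ξ} ξ → ∀ e ∈ E n, a ζ < e → a ξ < e)
    {ζ : Ordinal.{u}} (hζ : ζ ∈ ⋂ n, d n) :
    ∃ ξ ∈ ⋂ n, d n, ζ < ξ ∧ a ξ = ⨆ n, sInf {e | e ∈ E n ∧ a ζ < e} := by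
  have hζ' : ∀ n, ζ ∈ d n := Set.mem_iInter.1 hζ
  have hζo : ζ < o := (hd 0).lt (hζ' 0)
  have hanti : ∀ {m n}, m ≤ n → d n ⊆ d m := fun {m n} h ↦ antitone_nat_of_succ_le hsub h
  choose ξ hξ using fun n ↦ show ∃ ξ, IsLeast {ξ | ξ ∈ d n ∧ ζ < ξ} ξ by
    obtain ⟨y, hy, hζy⟩ := (hd n).exists_gt ho hζo
    exact ⟨_, isLeast_csInf ⟨y, hy, hζy⟩⟩
  have hξo : ∀ n, ξ n < o := fun n ↦ (hd n).lt (hξ n).1.1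
  have hmono : Monotone ξ := monotone_nat_of_le_succ fun n ↦
    (hξ n).2 ⟨hsub n (hξ (n + 1)).1.1, (hξ (n + 1)).1.2⟩
  have hs : ∀ n, IsLeast {e | e ∈ E n ∧ a ζ < e} (sInf {e | e ∈ E n ∧ a ζ < e}) := fun n ↦ by
    obtain ⟨y, hy, hζy⟩ := (hE n).exists_gt hl ((ha.lt ζ hζo).trans hδ)
    exact isLeast_csInf ⟨y, hy, hζy⟩
  -- The next points of `E n` interleave with the values `a (ξ n)`, so both sequences have the same
  -- supremum.
  have hlo : ∀ n, a (ξ n) < sInf {e | e ∈ E n ∧ a ζ < e} := fun n ↦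
    (hgap n ζ (hζ' _)).2 _ (hξ n) _ (hs n).1.1 (hs n).1.2
  have hhi : ∀ n, sInf {e | e ∈ E n ∧ a ζ < e} ≤ a (ξ (n + 1)) := fun n ↦
    (hs n).2 ⟨(hgap n _ (hξ (n + 1)).1.1).1, (ha.lt_iff hζo (hξo _)).2 (hξ (n + 1)).1.2⟩
  have hlub : IsLUB (Set.range ξ) (⨆ n, ξ n) :=
    ⟨by rintro _ ⟨n, rfl⟩; exact Ordinal.le_iSup ξ n, fun b hb ↦ Ordinal.iSup_le fun n ↦ hb ⟨n, rfl⟩⟩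
  have hsup : ⨆ n, ξ n < o := by
    refine lift_iSup_lt_of_lt_cof ?_ hξo
    rw [← lift_cof]
    simpa using ho'
  refine ⟨⨆ n, ξ n, Set.mem_iInter.2 fun m ↦ ?_, (hξ 0).1.2.trans_le (Ordinal.le_iSup ξ 0), ?_⟩
  -- Only the tail from `m` on is known to lie in `d m`; monotonicity of `ξ` gives it the same
  -- supremum.
  · refine (hd m).mem_of_isLUB (t := (fun n ↦ ξ (m + n)) '' Set.univ) ?_ ⟨_, 0, trivial, rfl⟩ hsup
      ⟨?_, fun b hb ↦ Ordinal.iSup_le fun n ↦ (hmono (Nat.le_add_left n m)).trans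
        (hb ⟨n, trivial, rfl⟩)⟩
    · rintro _ ⟨n, -, rfl⟩
      exact hanti (Nat.le_add_right m n) (hξ (m + n)).1.1
    · rintro _ ⟨n, -, rfl⟩
      exact Ordinal.le_iSup ξ _
  · refine (ha.isLUB_image (Set.range_nonempty ξ) hsup hlub).unique ⟨?_, fun b hb ↦ ?_⟩
    · rintro _ ⟨_, ⟨n, rfl⟩, rfl⟩
      exact (hlo n).le.trans (Ordinal.le_iSup (fun n ↦ sInf {e | e ∈ E n ∧ a ζ < e}) n)
    · exact Ordinal.iSup_le fun n ↦ (hhi n).trans (hb ⟨_, ⟨n + 1, rfl⟩, rfl⟩)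

theorem exists_jump_function (hμ : μ.IsRegular) (hμ' : Cardinal.aleph0 < μ)
    (hlam : lam.IsRegular) (hlam' : Cardinal.aleph0 < lam)
    (hcof : ∀ δ ∈ S, δ.cof = μ) (hstat : IsStationaryIn S lam.ord)
    (ha : ∀ δ ∈ S, IsLadder (a δ) μ.ord δ) :
    ∃ h : Ordinal.{u} → Ordinal.{u} → Ordinal.{u},
      (∀ δ ∈ S, ∀ ζ < μ.ord, ζ < h δ ζ ∧ h δ ζ < μ.ord) ∧
      ∀ E, IsClubIn E lam.ord →
        ∃ δ ∈ S, δ ∈ E ∧ IsStationaryIn (jumpSet (a δ) (h δ) E μ.ord) μ.ord := by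
  have hμlim : Order.IsSuccLimit μ.ord := Cardinal.isSuccLimit_ord hμ.aleph0_le
  have hllim : Order.IsSuccLimit lam.ord := Cardinal.isSuccLimit_ord hlam.aleph0_le
  have hμcof : Cardinal.aleph0 < μ.ord.cof := by rwa [hμ.cof_ord]
  have hlcof : Cardinal.aleph0 < lam.ord.cof := by rwa [hlam.cof_ord]
  by_contra! hno
  choose! d' E E' hd' hE hE' hsub hgap using
    exists_refinement_of_no_jump hμ hμ' hlam hlam' ha hno
  let d : ℕ → Ordinal.{u} → Set Ordinal.{u} := fun n ↦ d'^[n] fun _ ↦ Set.Iio μ.ord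
  have hds : ∀ n, d (n + 1) = d' (d n) := fun n ↦ Function.iterate_succ_apply' ..
  have hd : ∀ n, ∀ δ ∈ S, IsClubIn (d n δ) μ.ord := by
    intro n
    induction n with
    | zero => exact fun δ _ ↦ IsClubIn.Iio _
    | succ n ih => rw [hds]; exact hd' _ ih
  -- No `δ` occurs here: one successor function serves all the limit ladders.
  let σ : Ordinal.{u} → Ordinal.{u} := fun x ↦ ⨆ n, sInf {e | e ∈ E (d n) ∧ x < e}
  let D : Ordinal.{u} → Set Ordinal.{u} := fun δ ↦ ⋂ n, d n δ
  have hD : ∀ δ ∈ S, IsClubIn (D δ) μ.ord := fun δ hδ ↦ .iInter hμcof fun n ↦ hd n δ hδ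
  have hF : IsClubIn (⋂ n, E' (d n)) lam.ord := .iInter hlcof fun n ↦ hE' _ (hd n)
  have hnext : ∀ δ ∈ S, δ ∈ ⋂ n, E' (d n) → ∀ x ∈ a δ '' D δ, x < σ x ∧ σ x ∈ a δ '' D δ := by
    rintro δ hδ hδF _ ⟨ζ, hζ, rfl⟩
    obtain ⟨ξ, hξ, hlt, heq⟩ := exists_next_of_refinements (d := fun n ↦ d n δ)
      (E := fun n ↦ E (d n)) hμlim hμcof (hstat.1 hδ) hllim (ha δ hδ) (fun n ↦ hd n δ hδ)
      (fun n ↦ hE _ (hd n)) (fun n ↦ by rw [hds]; exact hsub _ (hd n) δ hδ)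
      (fun n ↦ by rw [hds]; exact hgap _ (hd n) δ hδ (Set.mem_iInter.1 hδF n)) hζ
    have heq' : a δ ξ = σ (a δ ζ) := heq
    rw [← heq']
    exact ⟨((ha δ hδ).lt_iff ((hD δ hδ).lt hζ) ((hD δ hδ).lt hξ)).2 hlt, ξ, hξ, rfl⟩
  choose! m hm using fun δ (hδ : δ ∈ S) ↦ (hD δ hδ).exists_ge hμ.ord_pos
  have hdisj : ∀ δ ∈ S ∩ ⋂ n, E' (d n), ∀ δ' ∈ S ∩ ⋂ n, E' (d n), δ < δ' →
      a δ (m δ) ≠ a δ' (m δ') := fun δ hδ δ' hδ' hlt heq ↦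
    Set.disjoint_left.1 ((ha δ' hδ'.1).disjoint_of_closed (hcof δ hδ.1) hlt
      ((ha δ hδ.1).isClubIn_image (hD δ hδ.1)) (hD δ' hδ'.1) (hnext δ hδ.1 hδ.2)
      fun x hx ↦ (hnext δ' hδ'.1 hδ'.2 x hx).2) ⟨_, (hm δ hδ.1).1, rfl⟩
      ⟨_, (hm δ' hδ'.1).1, heq.symm⟩
  refine not_isStationaryIn_of_injOn_regressive hlam hlam' (S := S ∩ ⋂ n, E' (d n))
    (f := fun δ ↦ a δ (m δ)) (fun δ hδ ↦ (ha δ hδ.1).lt _ ((hD δ hδ.1).lt (hm δ hδ.1).1))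
    (fun δ hδ δ' hδ' heq ↦ ?_) ⟨Set.inter_subset_left.trans hstat.1, fun C hC ↦ ?_⟩
  · obtain h | h | h := lt_trichotomy δ δ'
    exacts [absurd heq (hdisj δ hδ δ' hδ' h), h, absurd heq.symm (hdisj δ' hδ' δ hδ h)]
  · obtain ⟨x, hx, hx'⟩ := hstat.2 _ (hF.inter hlcof hC)
    exact ⟨x, ⟨hx, hx'.1⟩, hx'.2⟩

end Gap

/-! ### Guessing by last points, and the final ladders. -/

section Guess

variable {μ lam : Cardinal.{u}} {S : Set Ordinal.{u}} {a h : Ordinal.{u} → Ordinal.{u} → Ordinal.{u}}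

/-- The set of indices at which the last point of `E₀` up to the `h ζ`-th element of `a` lies beyond
the `ζ`-th one and belongs to `E`. -/
def lastPointSet (a h : Ordinal.{u} → Ordinal.{u}) (E₀ E : Set Ordinal.{u}) (o : Ordinal.{u}) :
    Set Ordinal.{u} :=
  {ζ | ζ < o ∧ a ζ < sSup (E₀ ∩ Set.Iic (a (h ζ))) ∧ sSup (E₀ ∩ Set.Iic (a (h ζ))) ∈ E}

theorem exists_lastPoint_guess (hμ : μ.IsRegular) (hμ' : Cardinal.aleph0 < μ)
    (hlam : lam.IsRegular) (hlam' : Cardinal.aleph0 < lam) (hS : S ⊆ Set.Iio lam.ord)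
    (ha : ∀ δ ∈ S, IsLadder (a δ) μ.ord δ)
    (hh : ∀ δ ∈ S, ∀ ζ < μ.ord, ζ < h δ ζ ∧ h δ ζ < μ.ord)
    (hjump : ∀ E, IsClubIn E lam.ord →
        ∃ δ ∈ S, δ ∈ E ∧ IsStationaryIn (jumpSet (a δ) (h δ) E μ.ord) μ.ord) :
    ∃ E₀, ∀ E, IsClubIn E lam.ord →
      ∃ δ ∈ S, δ ∈ E ∧ IsStationaryIn (lastPointSet (a δ) (h δ) E₀ E μ.ord) μ.ord := by
  have hμcof : Cardinal.aleph0 < μ.ord.cof := by rwa [hμ.cof_ord]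
  have hlcof : Cardinal.aleph0 < lam.ord.cof := by rwa [hlam.cof_ord]
  by_contra! hno
  choose F hF hFno using hno
  let E : ℕ → Set Ordinal.{u} := fun n ↦ (fun E₀ ↦ E₀ ∩ F E₀)^[n] (Set.Iio lam.ord)
  have hEs : ∀ n, E (n + 1) = E n ∩ F (E n) := fun n ↦ Function.iterate_succ_apply' ..
  have hE : ∀ n, IsClubIn (E n) lam.ord := by
    intro n
    induction n with
    | zero => exact .Iio _
    | succ n ih => rw [hEs]; exact ih.inter hlcof (hF _)
  have hanti : ∀ n, E (n + 1) ⊆ E n := fun n ↦ by rw [hEs]; exact Set.inter_subset_left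
  obtain ⟨δ, hδ, hδE, hst⟩ := hjump _ (IsClubIn.iInter hlcof hE)
  have hδE' : ∀ n, δ ∈ F (E n) := fun n ↦ by
    have := Set.mem_iInter.1 hδE (n + 1)
    rw [hEs] at this
    exact this.2
  choose C hC hCd using fun n ↦ not_isStationaryIn (fun ζ hζ ↦ hζ.1) (hFno (E n) δ hδ (hδE' n))
  obtain ⟨ζ, ⟨hζ, e, he, hlt, hle⟩, hζC⟩ := hst.2 _ (IsClubIn.iInter hμcof hC)
  let β : ℕ → Ordinal.{u} := fun n ↦ sSup (E n ∩ Set.Iic (a δ (h δ ζ)))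
  have hmem : ∀ n, e ∈ E n ∩ Set.Iic (a δ (h δ ζ)) := fun n ↦ ⟨Set.mem_iInter.1 he n, hle⟩
  have hbdd : ∀ n, BddAbove (E n ∩ Set.Iic (a δ (h δ ζ))) := fun n ↦
    ⟨a δ (h δ ζ), fun x hx ↦ hx.2⟩
  have hlub : ∀ n, IsLUB (E n ∩ Set.Iic (a δ (h δ ζ))) (β n) := fun n ↦
    isLUB_csSup ⟨e, hmem n⟩ (hbdd n)
  have hβE : ∀ n, β n ∈ E n := fun n ↦ (hE n).mem_of_isLUB Set.inter_subset_left ⟨e, hmem n⟩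
    (((hlub n).2 fun x hx ↦ hx.2).trans_lt (((ha δ hδ).lt _ (hh δ hδ ζ hζ).2).trans (hS hδ)))
    (hlub n)
  -- The ordinals `β n` cannot strictly decrease forever.
  obtain ⟨n, hn⟩ : ∃ n, β n ≤ β (n + 1) := by
    obtain ⟨_, ⟨n, rfl⟩, hn⟩ := WellFounded.has_min wellFounded_lt (Set.range β) ⟨_, 0, rfl⟩
    exact ⟨n, not_lt.1 (hn _ ⟨n + 1, rfl⟩)⟩
  have heq : β n = β (n + 1) :=
    hn.antisymm ((hlub (n + 1)).2 fun x hx ↦ (hlub n).1 ⟨hanti n hx.1, hx.2⟩)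
  refine hCd n ζ (Set.mem_iInter.1 hζC n) ⟨hζ, hlt.trans_le ((hlub n).1 (hmem n)), ?_⟩
  have h1 := hβE (n + 1)
  rw [← heq, hEs] at h1
  exact h1.2

/-- The points of `k`, with the value at a successor `ζ + 1` replaced by `b (k ζ)`. -/
noncomputable def interleave (a b k : Ordinal.{u} → Ordinal.{u}) (ζ : Ordinal.{u}) :
    Ordinal.{u} :=
  open Classical in
  if h : ∃ ξ, ζ = ξ + 1 then b (k h.choose) else a (k ζ)

theorem interleave_add_one (a b k : Ordinal.{u} → Ordinal.{u}) (ζ : Ordinal.{u}) :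
    interleave a b k (ζ + 1) = b (k ζ) := by
  have h : ∃ ξ, ζ + 1 = ξ + 1 := ⟨ζ, rfl⟩
  rw [interleave, dif_pos h, ← Order.succ_injective (a₁ := ζ) (a₂ := h.choose) h.choose_spec]

theorem interleave_of_isSuccPrelimit (a b k : Ordinal.{u} → Ordinal.{u}) {ζ : Ordinal.{u}}
    (hζ : Order.IsSuccPrelimit ζ) : interleave a b k ζ = a (k ζ) := by
  rw [interleave, dif_neg]
  rintro ⟨ξ, rfl⟩
  exact hζ.succ_ne ξ rfl

/-- Each inserted point lies in `(a (k ζ), a (k (ζ + 1))]`, so order, suprema at limits and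
cofinality are those of `a ∘ k`. -/
theorem IsLadder.interleave {o δ : Ordinal.{u}} (ho : Order.IsSuccLimit o)
    {a b h k : Ordinal.{u} → Ordinal.{u}} (ha : IsLadder a o δ) (hk : IsLadder k o o)
    (hks : ∀ ζ < o, k (ζ + 1) = h (k ζ))
    (hb : ∀ ζ < o, a ζ < b ζ ∧ b ζ ≤ a (h ζ)) : IsLadder (interleave a b k) o δ := by
  have hsucc : ∀ ζ < o, ζ + 1 < o := fun ζ hζ ↦ ho.succ_lt hζ
  have hle : ∀ ζ < o, _root_.interleave a b k ζ ≤ a (k ζ) := by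
    intro ζ hζ
    obtain ⟨ξ, rfl⟩ | hlim := Order.mem_range_succ_or_isSuccPrelimit ζ
    · have hξ : ξ < o := (Order.lt_succ ξ).trans hζ
      have := interleave_add_one a b k ξ
      rw [Order.succ_eq_add_one, this, hks ξ hξ]
      exact (hb _ (hk.lt ξ hξ)).2
    · exact (interleave_of_isSuccPrelimit a b k hlim).le
  have hlt : ∀ ζ < o, a (k ζ) < _root_.interleave a b k (ζ + 1) := fun ζ hζ ↦ by
    rw [interleave_add_one]
    exact (hb _ (hk.lt ζ hζ)).1
  have hak : ∀ {x y}, x ≤ y → y < o → a (k x) ≤ a (k y) := fun hxy hy ↦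
    (ha.le_iff (hk.lt _ (hxy.trans_lt hy)) (hk.lt _ hy)).2
      ((hk.le_iff (hxy.trans_lt hy) hy).2 hxy)
  have hge : ∀ x y, x < y → y < o → a (k x) < _root_.interleave a b k y := by
    intro x y hxy hy
    obtain ⟨ξ, rfl⟩ | hlim := Order.mem_range_succ_or_isSuccPrelimit y
    · have hξ : ξ < o := (Order.lt_succ ξ).trans hy
      exact (hak (Order.lt_succ_iff.1 hxy) hξ).trans_lt (hlt ξ hξ)
    · rw [interleave_of_isSuccPrelimit a b k hlim]
      exact (ha.lt_iff (hk.lt _ (hxy.trans hy)) (hk.lt _ hy)).2 ((hk.lt_iff (hxy.trans hy) hy).2 hxy)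
  refine ⟨fun x hx y hy hxy ↦ (hle x hx).trans_lt (hge x y hxy hy), fun ζ hζ hlim ↦ ?_,
    fun ζ hζ ↦ (hle ζ hζ).trans_lt (ha.lt _ (hk.lt ζ hζ)), fun x hx ↦ ?_⟩
  · rw [interleave_of_isSuccPrelimit a b k hlim.isSuccPrelimit]
    have hlub := ha.isLUB_image (Set.image_nonempty.2 ⟨0, hlim.bot_lt⟩) (hk.lt ζ hζ)
      (hk.continuous ζ hζ hlim)
    refine ⟨?_, fun c hc ↦ hlub.2 ?_⟩
    · rintro _ ⟨x, hx, rfl⟩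
      exact (hle x (lt_trans hx hζ)).trans (hak (le_of_lt hx) hζ)
    · rintro _ ⟨_, ⟨x, hx, rfl⟩, rfl⟩
      have hx1 : x + 1 < ζ := hlim.succ_lt hx
      exact (hlt x (lt_trans hx hζ)).le.trans (hc ⟨x + 1, hx1, rfl⟩)
  · obtain ⟨ζ, hζ, hxζ⟩ := ha.cofinal x hx
    obtain ⟨ξ, hξ, hζξ⟩ := hk.cofinal ζ hζ
    exact ⟨ξ + 1, hsucc ξ hξ, hxζ.trans
      (((ha.lt_iff hζ (hk.lt ξ hξ)).2 hζξ).trans (hlt ξ hξ))⟩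

theorem StrictMonoOn.le_apply_of_lt {o : Ordinal.{u}} {k : Ordinal.{u} → Ordinal.{u}}
    (hk : StrictMonoOn k (Set.Iio o)) {ζ : Ordinal.{u}} (hζ : ζ < o) : ζ ≤ k ζ := by
  induction ζ using WellFoundedLT.induction with
  | ind ζ ih =>
    by_contra! hlt
    exact (ih _ hlt (hlt.trans hζ)).not_gt (hk (hlt.trans hζ) hζ hlt)

theorem exists_isLadder_iterate {c : Cardinal.{u}} (hc : c.IsRegular)
    {h : Ordinal.{u} → Ordinal.{u}} (hh : ∀ ζ < c.ord, ζ < h ζ ∧ h ζ < c.ord) :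
    ∃ k, IsLadder k c.ord c.ord ∧ ∀ ζ, k (ζ + 1) = h (k ζ) := by
  have hclim : Order.IsSuccLimit c.ord := Cardinal.isSuccLimit_ord hc.aleph0_le
  obtain ⟨k, hk, hkc, hkl, hks⟩ := exists_continuous_recursion hc hc.cof_ord (fun _ ↦ h)
    fun _ _ x hx ↦ hh x hx
  have hge : ∀ ζ < c.ord, ζ ≤ k ζ := fun ζ hζ ↦ hk.le_apply_of_lt hζ
  refine ⟨k, ⟨hk, hkc, hkl, fun x hx ↦ ⟨x + 1, hclim.succ_lt hx, ?_⟩⟩, hks⟩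
  exact (lt_add_one x).trans_le (hge _ (hclim.succ_lt hx))

theorem IsLadder.exists_isClubIn_fixed {c : Cardinal.{u}} (hc : c.IsRegular)
    (hc' : Cardinal.aleph0 < c) {k : Ordinal.{u} → Ordinal.{u}} (hk : IsLadder k c.ord c.ord) :
    ∃ D, IsClubIn D c.ord ∧ ∀ ζ ∈ D, k ζ = ζ := by
  have hclim : Order.IsSuccLimit c.ord := Cardinal.isSuccLimit_ord hc.aleph0_le
  refine ⟨_, isClubIn_closurePoints hc hc' (g := fun x ↦ max (k x) (x + 1))
    fun x hx ↦ max_lt (hk.lt x hx) (hclim.succ_lt hx), fun ζ ⟨hζ, hζ0, hcl⟩ ↦ ?_⟩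
  have hlim : Order.IsSuccLimit ζ := by
    refine Ordinal.isSuccLimit_iff.2 ⟨hζ0.ne', Order.isSuccPrelimit_of_succ_ne fun z hz ↦ ?_⟩
    have h1 := hcl z (hz ▸ Order.lt_succ z)
    exact ((le_max_right _ _).trans_lt h1).ne hz
  refine ((hk.continuous ζ hζ hlim).2 ?_).antisymm ?_
  · rintro _ ⟨x, hx, rfl⟩
    exact ((le_max_left _ _).trans_lt (hcl x hx)).le
  · exact hk.strictMonoOn.le_apply_of_lt hζ

theorem IsLadder.type_image {c : Cardinal.{u}} {a : Ordinal.{u} → Ordinal.{u}} {δ : Ordinal.{u}}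
    (ha : IsLadder a c.ord δ) :
    Ordinal.type (fun x y : (a '' Set.Iio c.ord : Set Ordinal.{u}) ↦ x < y) =
      Ordinal.lift.{u + 1} c.ord := by
  rw [← type_lt_Iio]
  exact (ha.strictMonoOn.orderIso a (Set.Iio c.ord)).toRelIsoLT.ordinalType_congr.symm

end Guess

theorem claim3p2 (μ lam : Cardinal.{u}) (hμ : μ.IsRegular) (hμ' : Cardinal.aleph0 < μ)
    (hlam : lam = Order.succ μ) (S : Set Ordinal.{u})
    (hS : S ⊆ {δ | δ < lam.ord ∧ δ.cof = μ}) (hSstat : IsStationaryIn S lam.ord) :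
    ∃ (C : Ordinal.{u} → Set Ordinal.{u}) (α : Ordinal.{u} → Ordinal.{u} → Ordinal.{u}),
      IsStrictClubSystem S C ∧
      (∀ δ ∈ S, IsContEnum (α δ) μ.ord (C δ)) ∧
      ∀ E : Set Ordinal.{u}, IsClubIn E lam.ord →
        IsStationaryIn
          {δ | δ ∈ S ∧ IsStationaryIn {ζ | ζ < μ.ord ∧ α δ (ζ + 1) ∈ E} μ.ord}
          lam.ord := by
  have hlamr : lam.IsRegular := hlam ▸ Cardinal.isRegular_succ hμ.aleph0_le
  have hlam' : Cardinal.aleph0 < lam := hlam ▸ hμ'.trans (Order.lt_succ μ)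
  have hμcof : Cardinal.aleph0 < μ.ord.cof := by rwa [hμ.cof_ord]
  have hlcof : Cardinal.aleph0 < lam.ord.cof := by rwa [hlamr.cof_ord]
  have hμlim : Order.IsSuccLimit μ.ord := Cardinal.isSuccLimit_ord hμ.aleph0_le
  choose! a ha using fun δ (hδ : δ ∈ S) ↦ exists_isLadder hμ (hS hδ).2
  obtain ⟨h, hh, hjump⟩ := exists_jump_function hμ hμ' hlamr hlam' (fun δ hδ ↦ (hS hδ).2) hSstat ha
  obtain ⟨E₀, hE₀⟩ := exists_lastPoint_guess hμ hμ' hlamr hlam' hSstat.1 ha hh hjump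
  choose! k hk hks using fun δ (hδ : δ ∈ S) ↦ exists_isLadder_iterate hμ (hh δ hδ)
  classical
  -- When `E₀` has no useful last point, the fallback `a δ (h δ ζ)` keeps the sequence increasing.
  let b : Ordinal.{u} → Ordinal.{u} → Ordinal.{u} := fun δ ζ ↦
    if a δ ζ < sSup (E₀ ∩ Set.Iic (a δ (h δ ζ))) then sSup (E₀ ∩ Set.Iic (a δ (h δ ζ)))
    else a δ (h δ ζ)
  have hb : ∀ δ ∈ S, ∀ ζ < μ.ord, a δ ζ < b δ ζ ∧ b δ ζ ≤ a δ (h δ ζ) := by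
    intro δ hδ ζ hζ
    by_cases hlt : a δ ζ < sSup (E₀ ∩ Set.Iic (a δ (h δ ζ)))
    · simp only [b, if_pos hlt]
      exact ⟨hlt, csSup_le' fun x hx ↦ hx.2⟩
    · simp only [b, if_neg hlt]
      exact ⟨((ha δ hδ).lt_iff hζ (hh δ hδ ζ hζ).2).2 (hh δ hδ ζ hζ).1, le_rfl⟩
  let α : Ordinal.{u} → Ordinal.{u} → Ordinal.{u} := fun δ ↦ interleave (a δ) (b δ) (k δ)
  have hα : ∀ δ ∈ S, IsLadder (α δ) μ.ord δ := fun δ hδ ↦ (ha δ hδ).interleave hμlim (hk δ hδ)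
    (fun ζ _ ↦ hks δ hδ ζ) (hb δ hδ)
  refine ⟨fun δ ↦ α δ '' Set.Iio μ.ord, α, ⟨fun δ hδ ↦ ?_,
    fun δ hδ ↦ (hα δ hδ).isClubIn_image (.Iio _), fun δ hδ ↦ ?_⟩,
    fun δ hδ ↦ ⟨(hα δ hδ).strictMonoOn, (hα δ hδ).continuous, rfl⟩, fun E hE ↦
    ⟨fun δ hδ ↦ hSstat.1 hδ.1, fun C hC ↦ ?_⟩⟩
  · rw [← one_lt_cof_iff, (hS hδ).2]
    exact Cardinal.one_lt_aleph0.trans hμ'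
  · rw [(hS hδ).2]
    exact (hα δ hδ).type_image
  -- Guessing `E ∩ C` puts `δ` in `C` as well, which gives stationarity in `λ`.
  · obtain ⟨δ, hδ, hδE, hst⟩ := hE₀ _ (hE.inter hlcof hC)
    obtain ⟨D, hD, hDk⟩ := (hk δ hδ).exists_isClubIn_fixed hμ hμ'
    refine ⟨δ, ⟨hδ, fun ζ hζ ↦ hζ.1, fun B hB ↦ ?_⟩, hδE.2⟩
    obtain ⟨ζ, ⟨hζ, hlt, hmem⟩, hζD, hζB⟩ := hst.2 _ (hD.inter hμcof hB)
    refine ⟨ζ, ⟨hζ, ?_⟩, hζB⟩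
    simp only [α, interleave_add_one, hDk ζ hζD, b, if_pos hlt]
    exact hmem.1
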